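/- Write $\mathbb{N}=\{1,2,\dots\}$ and $\mathbb{Z}^\ast=\mathbb{Z}\setminus\{0\}$. **Words.** Let $\Sigma=\{\alpha_n:n\in\mathbb{Z}^\ast\}$ be an alphabet, let $\vec{k}=(k_n)_{n\in\mathbb{Z}^\ast}\subseteq\mathbb{N}$ be such that $(k_n)_{n\in\mathbb{N}}$ and $(k_{-n})_{n\in\mathbb{N}}$ are increasing (not necessarily strictly), and let $\upsilon\notin\Sigma$ (the variable). A word is a function $w$ from a non-empty finite set $\mathrm{dom}(w)\subset\mathbb{Z}^\ast$ to $\Sigma\cup\{\upsilon\}$ with $w_n\in\{\upsilon,\alpha_1,\dots,\alpha_{k_n}\}$ for $n>0$ and $w_n\in\{\upsilon,\alpha_{-k_n},\dots,\alpha_{-1}\}$ for $n<0$. $\widetilde{L}(\Sigma,\vec{k})$ is the set of words in which $\upsilon$ does not occur, and $\widetilde{L}_0(\Sigma,\vec{k};\upsilon)$ the set of words in which $\upsilon$ occurs both at a negative and at a positive position. If $\mathrm{dom}(w)\cap\mathrm{dom}(u)=\emptyset$, then $w\star u$ is the word on $\mathrm{dom}(w)\cup\mathrm{dom}(u)$ extending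 $w$ and $u$. We write $w<_{R_1}u$ if $\mathrm{dom}(u)=A_1\cup A_2$ with $A_1,A_2\ne\emptyset$ and $\max A_1<\min\mathrm{dom}(w)\le\max\mathrm{dom}(w)<\min A_2$, and $w<_{R_2}u$ if $\max\mathrm{dom}(w)<\min\mathrm{dom}(u)$. For the second version let $\Sigma=\{\alpha_n:n\in\mathbb{N}\}$, $\vec{k}=(k_n)_{n\in\mathbb{N}}\subseteq\mathbb{N}$ increasing; $L(\Sigma,\vec{k})$ and $L(\Sigma,\vec{k};\upsilon)$ are the sets of words with domain in $\mathbb{N}$, dominated by $\vec{k}$ in the same way, in which $\upsilon$ does not occur, respectively occurs. **Extractions.** Let $\widetilde{L}^\infty(\Sigma,\vec{k};\upsilon)$ be the set of sequences $\vec{w}=(w_n)_{n\in\mathbb{N}}$ in $\widetilde{L}_0(\Sigma,\vec{k};\upsilon)$ with $w_n<_{R_1}w_{n+1}$ for all $n$ (resp. $L^\infty(\Sigma,\vec{k};\upsilon)$ the set of sequences in $L(\Sigma,\vec{k};\upsilon)$ with $w_n<_{R_2}w_{n+1}$ for all $n$). Let $w(p,q)$ be obtained from $w$ by replacing $\upsilon$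 by $\alpha_p$ at positive positions and by $\alpha_{-q}$ at negative positions, and put $w(\upsilon,\upsilon)=w$ (resp. let $w(p)$ be obtained by replacing $\upsilon$ by $\alpha_p$, and put $w(\upsilon)=w$). $\widetilde{E}(\vec{w})$ (resp. $E(\vec{w})$) is the set of all words $w_{n_1}(p_1,q_1)\star\cdots\star w_{n_\lambda}(p_\lambda,q_\lambda)$ (resp. $w_{n_1}(p_1)\star\cdots\star w_{n_\lambda}(p_\lambda)$) with $\lambda\in\mathbb{N}$, $n_1<\dots<n_\lambda$ in $\mathbb{N}$, $1\le p_i\le k_{n_i}$ and $1\le q_i\le k_{-n_i}$. Allowing also $(p_i,q_i)=(\upsilon,\upsilon)$ (resp. $p_i=\upsilon$), and requiring it for at least one $i$, gives the set of extracted variable words of $\vec{w}$. An extraction $\vec{u}\prec\vec{w}$ is a sequence $\vec{u}\in\widetilde{L}^\infty(\Sigma,\vec{k};\upsilon)$ (resp. $L^\infty(\Sigma,\vec{k};\upsilon)$) all of whose terms are extracted variable words of $\vec{w}$. **Limits and systems.** For $\vec{u}\in\widetilde{L}^\infty(\Sigma,\vec{k};\upsilon)$, $R_1\text{-}\lim_{w\in\widetilde{E}(\vec{u})}x_w=x_0$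 means: for every neighbourhood $V$ of $x_0$ there is $n_0$ with $x_w\in V$ for all $w\in\widetilde{E}(\vec{u})$ such that $|n|\ge n_0$ for all $n\in\mathrm{dom}(w)$. For $\vec{u}\in L^\infty(\Sigma,\vec{k};\upsilon)$, $R_2\text{-}\lim_{w\in E(\vec{u})}x_w=x_0$ means: for every neighbourhood $V$ of $x_0$ there is $n_0$ with $x_w\in V$ for all $w\in E(\vec{u})$ with $\min\mathrm{dom}(w)\ge n_0$. An $\widetilde{L}(\Sigma,\vec{k})$-system (resp. $L(\Sigma,\vec{k})$-system) of a topological space $X$ is a family $\{T^w\}$ of continuous maps $X\to X$, indexed by $w\in\widetilde{L}(\Sigma,\vec{k})$ (resp. $w\in L(\Sigma,\vec{k})$), with $T^{w_1}T^{w_2}=T^{w_1\star w_2}$ whenever $w_1<_{R_1}w_2$ (resp. $w_1<_{R_2}w_2$). For a group $G$ of homeomorphisms of $X$, $(X,G)$ is minimal if no proper non-empty closed subset of $X$ is invariant under $G$. **Theorem.** Let $X$ be a non-empty compact metric space, let $\{T_1^w\},\dots,\{T_m^w\}$ be $m$ $\widetilde{L}(\Sigma,\vec{k})$-systems (resp.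 $L(\Sigma,\vec{k})$-systems) of $X$, all of whose maps belong to a commutative group $G$ of homeomorphisms of $X$, and let $\vec{w}\in\widetilde{L}^\infty(\Sigma,\vec{k};\upsilon)$ (resp. $\vec{w}\in L^\infty(\Sigma,\vec{k};\upsilon)$). Then there exist $x_0\in X$ and an extraction $\vec{u}\prec\vec{w}$ such that $$R_1\text{-}\lim_{w\in\widetilde{E}(\vec{u})}T_i^w(x_0)=x_0\qquad\Big(\text{resp. } R_2\text{-}\lim_{w\in E(\vec{u})}T_i^w(x_0)=x_0\Big)\qquad\text{for every }1\le i\le m.$$ Moreover, if $(X,G)$ is minimal, then the set of points $x_0\in X$ for which there is such an extraction $\vec{u}\prec\vec{w}$ is dense in $X$. -/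

import Mathlib

open Topology

namespace OmegaWords

/-- The letters `Σ ∪ {υ}`: the variable `υ` is distinct from every letter of the alphabet. -/
inductive Letter (A : Type*) where
  | var : Letter A
  | const (a : A) : Letter A

/-- Located words with positions in `I`, as partial functions: `w i = none` says that `i` is not
in the domain of `w`. The finiteness, non-emptiness and domination conditions are imposed below. -/
abbrev LocWord (I A : Type*) := I → Option (Letter A)

section General

variable {I A : Type*}

/-- The domain of a located word. -/
def LocWord.dom (w : LocWord I A) : Set I := {i | w i ≠ none}

/-- The concatenation `w ⋆ u` (used for words with disjoint domains): the word on
`dom w ∪ dom u` that agrees with `w` on `dom w` and with `u` on `dom u`. -/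
def LocWord.conc (w u : LocWord I A) : LocWord I A := fun i => (w i).or (u i)

/-- `w₁ ⋆ ⋯ ⋆ w_l` for a list of words. -/
def concList (l : List (LocWord I A)) : LocWord I A :=
  l.foldr LocWord.conc (fun _ => none)

/-- `w <_{R₁} u`. -/
def R1 [LT I] (w u : LocWord I A) : Prop :=
  ∃ A₁ A₂ : Set I, u.dom = A₁ ∪ A₂ ∧ A₁.Nonempty ∧ A₂.Nonempty ∧
    (∀ a ∈ A₁, ∀ i ∈ w.dom, a < i) ∧ (∀ i ∈ w.dom, ∀ b ∈ A₂, i < b)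

/-- `w <_{R₂} u`, i.e. `max dom w < min dom u`. -/
def R2 [LT I] (w u : LocWord I A) : Prop :=
  ∀ i ∈ w.dom, ∀ j ∈ u.dom, i < j

end General

/-! ### Words over positions in the nonzero integers

The alphabet is `Σ = {α n : n ∈ ℤ, n ≠ 0}` and the dominating sequence is `k n`, `n ≠ 0`; the
values `α 0` and `k 0` are never used. Sequences of words are indexed by `n = 1, 2, …`; the value
at `0` is never used. -/

section Integers

variable {A : Type*}

/-- Admissible dominating sequences `(k n)_{n ≠ 0}`: positive, with `(k n)_{n ≥ 1}` and
`(k (-n))_{n ≥ 1}` increasing (not necessarily strictly). -/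
def IsDominatingZ (k : ℤ → ℕ) : Prop :=
  (∀ n : ℤ, n ≠ 0 → 1 ≤ k n) ∧
  (∀ m n : ℤ, 1 ≤ m → m ≤ n → k m ≤ k n) ∧
  (∀ m n : ℤ, 1 ≤ m → m ≤ n → k (-m) ≤ k (-n))

/-- The set of all words over `Σ ∪ {υ}` dominated by `k`, constant or variable. -/
def WordsZ (α : ℤ → A) (k : ℤ → ℕ) : Set (LocWord ℤ A) :=
  {w | w.dom.Finite ∧ w.dom.Nonempty ∧ (0 : ℤ) ∉ w.dom ∧
    (∀ i : ℤ, 0 < i → ∀ a : A, w i = some (Letter.const a) →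
      ∃ j : ℕ, 1 ≤ j ∧ j ≤ k i ∧ a = α j) ∧
    (∀ i : ℤ, i < 0 → ∀ a : A, w i = some (Letter.const a) →
      ∃ j : ℕ, 1 ≤ j ∧ j ≤ k i ∧ a = α (-(j : ℤ)))}

/-- The constant words: the variable does not occur. -/
def ConstZ (α : ℤ → A) (k : ℤ → ℕ) : Set (LocWord ℤ A) :=
  {w | w ∈ WordsZ α k ∧ ∀ i : ℤ, w i ≠ some Letter.var}

/-- The variable words in which the variable occurs at a negative and at a positive position. -/
def VarZ₀ (α : ℤ → A) (k : ℤ → ℕ) : Set (LocWord ℤ A) :=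
  {w | w ∈ WordsZ α k ∧ (∃ i : ℤ, i < 0 ∧ w i = some Letter.var) ∧
    (∃ i : ℤ, 0 < i ∧ w i = some Letter.var)}

/-- The sequences `(w_n)_{n ≥ 1}` in `VarZ₀` with `w_n <_{R₁} w_{n+1}`. -/
def SeqZ (α : ℤ → A) (k : ℤ → ℕ) : Set (ℕ → LocWord ℤ A) :=
  {w | ∀ n : ℕ, 1 ≤ n → w n ∈ VarZ₀ α k ∧ R1 (w n) (w (n + 1))}

/-- Substitution: `some (p, q)` gives `w(p,q)`, where `υ` is replaced by `α p` at positive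
positions and by `α (-q)` at negative positions; `none` stands for `(υ,υ)` and gives `w`. -/
def substZ (α : ℤ → A) (w : LocWord ℤ A) : Option (ℕ × ℕ) → LocWord ℤ A
  | none => w
  | some (p, q) => fun i =>
    match w i with
    | some Letter.var =>
      if 0 < i then some (Letter.const (α p)) else some (Letter.const (α (-(q : ℤ))))
    | c => c

/-- The extracted (constant) words `w_{n₁}(p₁,q₁) ⋆ ⋯ ⋆ w_{n_l}(p_l,q_l)` of a sequence. -/
def EZ (α : ℤ → A) (k : ℤ → ℕ) (w : ℕ → LocWord ℤ A) : Set (LocWord ℤ A) :=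
  {z | z ∈ ConstZ α k ∧ ∃ (l : List ℕ) (p q : ℕ → ℕ),
    l ≠ [] ∧ l.Pairwise (· < ·) ∧
    (∀ n ∈ l, 1 ≤ n ∧ 1 ≤ p n ∧ p n ≤ k n ∧ 1 ≤ q n ∧ q n ≤ k (-(n : ℤ))) ∧
    z = concList (l.map fun n => substZ α (w n) (some (p n, q n)))}

/-- The extracted variable words of a sequence. -/
def EVZ (α : ℤ → A) (k : ℤ → ℕ) (w : ℕ → LocWord ℤ A) : Set (LocWord ℤ A) :=
  {z | z ∈ VarZ₀ α k ∧ ∃ (l : List ℕ) (s : ℕ → Option (ℕ × ℕ)),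
    l ≠ [] ∧ l.Pairwise (· < ·) ∧
    (∀ n ∈ l, 1 ≤ n ∧ ∀ p q : ℕ, s n = some (p, q) →
      1 ≤ p ∧ p ≤ k n ∧ 1 ≤ q ∧ q ≤ k (-(n : ℤ))) ∧
    (∃ n ∈ l, s n = none) ∧
    z = concList (l.map fun n => substZ α (w n) (s n))}

/-- `u ≺ w`: the sequence `u` is an extraction of `w`. -/
def IsExtractionZ (α : ℤ → A) (k : ℤ → ℕ) (u w : ℕ → LocWord ℤ A) : Prop :=
  u ∈ SeqZ α k ∧ ∀ n : ℕ, 1 ≤ n → u n ∈ EVZ α k w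

/-- `R₁`-`lim_{w ∈ E} x_w = x₀`: for every neighbourhood `V` of `x₀` there is `n₀` with `x_w ∈ V`
for all `w ∈ E` such that `min {-max dom⁻ w, min dom⁺ w} ≥ n₀`. -/
def R1Lim {X : Type*} [TopologicalSpace X] (E : Set (LocWord ℤ A)) (x : LocWord ℤ A → X)
    (x₀ : X) : Prop :=
  ∀ V ∈ 𝓝 x₀, ∃ n₀ : ℕ, ∀ w ∈ E,
    (∀ i ∈ w.dom, i < 0 → (n₀ : ℤ) ≤ -i) → (∀ i ∈ w.dom, 0 < i → (n₀ : ℤ) ≤ i) → x w ∈ V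

/-- Systems of continuous maps indexed by the constant words (the values of `T` at other words
play no role). -/
def IsSystemZ {X : Type*} [TopologicalSpace X] (α : ℤ → A) (k : ℤ → ℕ)
    (T : LocWord ℤ A → X → X) : Prop :=
  (∀ w ∈ ConstZ α k, Continuous (T w)) ∧
  ∀ w₁ ∈ ConstZ α k, ∀ w₂ ∈ ConstZ α k, R1 w₁ w₂ → T w₁ ∘ T w₂ = T (w₁.conc w₂)

end Integers

/-! ### Words over positions in the positive integers

As above, with alphabet `Σ = {α n : n ≥ 1}` and dominating sequence `k n`, `n ≥ 1`. -/

section Naturals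

variable {A : Type*}

/-- Admissible dominating sequences `(k n)_{n ≥ 1}`. -/
def IsDominatingN (k : ℕ → ℕ) : Prop :=
  (∀ n : ℕ, 1 ≤ n → 1 ≤ k n) ∧ (∀ m n : ℕ, 1 ≤ m → m ≤ n → k m ≤ k n)

/-- The set of all words over `Σ ∪ {υ}` dominated by `k`, constant or variable. -/
def WordsN (α : ℕ → A) (k : ℕ → ℕ) : Set (LocWord ℕ A) :=
  {w | w.dom.Finite ∧ w.dom.Nonempty ∧ 0 ∉ w.dom ∧
    ∀ i : ℕ, 1 ≤ i → ∀ a : A, w i = some (Letter.const a) →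
      ∃ j : ℕ, 1 ≤ j ∧ j ≤ k i ∧ a = α j}

/-- The constant words. -/
def ConstN (α : ℕ → A) (k : ℕ → ℕ) : Set (LocWord ℕ A) :=
  {w | w ∈ WordsN α k ∧ ∀ i : ℕ, w i ≠ some Letter.var}

/-- The variable words. -/
def VarN (α : ℕ → A) (k : ℕ → ℕ) : Set (LocWord ℕ A) :=
  {w | w ∈ WordsN α k ∧ ∃ i : ℕ, w i = some Letter.var}

/-- The sequences `(w_n)_{n ≥ 1}` of variable words with `w_n <_{R₂} w_{n+1}`. -/
def SeqN (α : ℕ → A) (k : ℕ → ℕ) : Set (ℕ → LocWord ℕ A) :=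
  {w | ∀ n : ℕ, 1 ≤ n → w n ∈ VarN α k ∧ R2 (w n) (w (n + 1))}

/-- Substitution: `some p` gives `w(p)`, and `none` stands for `υ` and gives `w`. -/
def substN (α : ℕ → A) (w : LocWord ℕ A) : Option ℕ → LocWord ℕ A
  | none => w
  | some p => fun i =>
    match w i with
    | some Letter.var => some (Letter.const (α p))
    | c => c

/-- The extracted (constant) words `w_{n₁}(p₁) ⋆ ⋯ ⋆ w_{n_l}(p_l)` of a sequence. -/
def EN (α : ℕ → A) (k : ℕ → ℕ) (w : ℕ → LocWord ℕ A) : Set (LocWord ℕ A) :=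
  {z | z ∈ ConstN α k ∧ ∃ (l : List ℕ) (p : ℕ → ℕ),
    l ≠ [] ∧ l.Pairwise (· < ·) ∧
    (∀ n ∈ l, 1 ≤ n ∧ 1 ≤ p n ∧ p n ≤ k n) ∧
    z = concList (l.map fun n => substN α (w n) (some (p n)))}

/-- The extracted variable words of a sequence. -/
def EVN (α : ℕ → A) (k : ℕ → ℕ) (w : ℕ → LocWord ℕ A) : Set (LocWord ℕ A) :=
  {z | z ∈ VarN α k ∧ ∃ (l : List ℕ) (s : ℕ → Option ℕ),
    l ≠ [] ∧ l.Pairwise (· < ·) ∧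
    (∀ n ∈ l, 1 ≤ n ∧ ∀ p : ℕ, s n = some p → 1 ≤ p ∧ p ≤ k n) ∧
    (∃ n ∈ l, s n = none) ∧
    z = concList (l.map fun n => substN α (w n) (s n))}

/-- `u ≺ w`: the sequence `u` is an extraction of `w`. -/
def IsExtractionN (α : ℕ → A) (k : ℕ → ℕ) (u w : ℕ → LocWord ℕ A) : Prop :=
  u ∈ SeqN α k ∧ ∀ n : ℕ, 1 ≤ n → u n ∈ EVN α k w

/-- `R₂`-`lim_{w ∈ E} x_w = x₀`: for every neighbourhood `V` of `x₀` there is `n₀` with `x_w ∈ V`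
for all `w ∈ E` such that `min dom w ≥ n₀`. -/
def R2Lim {X : Type*} [TopologicalSpace X] (E : Set (LocWord ℕ A)) (x : LocWord ℕ A → X)
    (x₀ : X) : Prop :=
  ∀ V ∈ 𝓝 x₀, ∃ n₀ : ℕ, ∀ w ∈ E, (∀ i ∈ w.dom, n₀ ≤ i) → x w ∈ V

/-- Systems of continuous maps indexed by the constant words (the values of `T` at other words
play no role). -/
def IsSystemN {X : Type*} [TopologicalSpace X] (α : ℕ → A) (k : ℕ → ℕ)
    (T : LocWord ℕ A → X → X) : Prop :=
  (∀ w ∈ ConstN α k, Continuous (T w)) ∧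
  ∀ w₁ ∈ ConstN α k, ∀ w₂ ∈ ConstN α k, R2 w₁ w₂ → T w₁ ∘ T w₂ = T (w₁.conc w₂)

end Naturals

/-- `(X, G)` is minimal: no proper non-empty closed subset of `X` is invariant under `G`. -/
def IsMinimalGroup {X : Type*} [TopologicalSpace X] (G : Subgroup (X ≃ₜ X)) : Prop :=
  ∀ B : Set X, IsClosed B → B.Nonempty → (∀ g ∈ G, g '' B ⊆ B) → B = Set.univ

end OmegaWords

open OmegaWords

/-!
The extraction can be chosen without substituting any letter: every term `u n` is a concatenation
`⋆_{j ∈ V n} w j` over a finite block `V n` of indices, with `V 1 < V 2 < ⋯`. Since a system is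
multiplicative along consecutive words, `T i` of `u n` with the variable replaced by a letter `a`
is the product over `j ∈ V n` of the elements `S i j a = T i (w j with a for the variable)` of the
commutative group, so the theorem becomes a recurrence statement about such block products.

Let `Y` be a minimal non-empty closed invariant set and `U` an open set meeting `Y`. Finitely many
translates of `U` cover `Y` (`exists_finset_smul_mem`), and the Hales-Jewett theorem over the
alphabet of all pairs `(i, a)`, together with a letter for the identity, turns this into a block
`V` and a point `y ∈ U ∩ Y` whose images under the block products over `V` lie in `U`, for all `i`
and all `a` from a given finite set (`exists_finset_prod_smul_mem`). By continuity the same block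
maps a small neighbourhood of `y` into `U`; iterating gives open sets `U = W 0 ⊇ W 1 ⊇ ⋯` shrinking
to a point `x₀`, with the products over `V (n + 1)` mapping `W (n + 1)` into `W n`
(`exists_nested_blocks`). Applying the factors of `T i z` one after the other, from the last index
to the first index `n₁`, moves `x₀` along these sets into `W (n₁ - 1)`, and `n₁` tends to infinity
with the distance of the positions of `z` from `0` (`exists_recurrent_point`,
`exists_recurrent_blocks`).

A minimal `Y` always exists by Zorn's lemma, which gives the existence of `x₀`; when the whole
space is minimal, `U` can be any non-empty open set, which gives the density. The finite set of
letters available to `u n` is fixed before the block `V n` is chosen, and all `j ∈ V n` satisfy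
`j ≥ n`, so those letters are admissible in `w j` because the dominating sequence is increasing.
-/

namespace OmegaWords

/-! ### Multiple recurrence for commuting actions -/

section Dynamics

variable {H X : Type*}

/-- The non-empty closed invariant subsets of an action. -/
def IsClosedInvariant (H : Type*) {X : Type*} [TopologicalSpace X] [SMul H X] (B : Set X) : Prop :=
  IsClosed B ∧ B.Nonempty ∧ ∀ g : H, ∀ x ∈ B, g • x ∈ B

theorem exists_minimal_isClosedInvariant (H X : Type*) [TopologicalSpace X] [CompactSpace X]
    [Nonempty X] [SMul H X] : ∃ Y : Set X, Minimal (IsClosedInvariant H) Y := by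
  have hchain : ∀ c ⊆ {B : Set X | IsClosedInvariant H B}, IsChain (· ⊆ ·) c → c.Nonempty →
      ∃ lb ∈ {B : Set X | IsClosedInvariant H B}, ∀ s ∈ c, lb ⊆ s := by
    intro c hc hchain hne
    refine ⟨⋂₀ c, ⟨isClosed_sInter fun s hs => (hc hs).1, ?_, ?_⟩,
      fun s hs => Set.sInter_subset_of_mem hs⟩
    · have : Nonempty c := hne.to_subtype
      exact IsCompact.nonempty_sInter_of_directed_nonempty_isCompact_isClosed
        (fun s hs t ht => (hchain.total hs ht).elim (fun h => ⟨s, hs, subset_rfl, h⟩)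
          fun h => ⟨t, ht, h, subset_rfl⟩)
        (fun s hs => (hc hs).2.1) (fun s hs => (hc hs).1.isCompact) (fun s hs => (hc hs).1)
    · exact fun g x hx s hs => (hc hs).2.2 g x (hx s hs)
  obtain ⟨Y, -, hY⟩ := zorn_superset_nonempty _ hchain Set.univ
    ⟨isClosed_univ, Set.univ_nonempty, fun _ _ _ => trivial⟩
  exact ⟨Y, hY⟩

/-- In a minimal set, finitely many translates of a relatively open set cover. -/
theorem exists_finset_smul_mem [Group H] [TopologicalSpace X] [CompactSpace X] [MulAction H X]
    [ContinuousConstSMul H X] {Y : Set X} (hY : Minimal (IsClosedInvariant H) Y) {U : Set X}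
    (hU : IsOpen U) (hUY : (U ∩ Y).Nonempty) : ∃ F : Finset H, ∀ y ∈ Y, ∃ f ∈ F, f • y ∈ U := by
  have hcov : Y ⊆ ⋃ g : H, (fun x : X => g • x) ⁻¹' U := by
    -- otherwise the points whose orbit avoids `U` form a smaller closed invariant set
    by_contra hne
    obtain ⟨y, hyY, hy⟩ := Set.not_subset.1 hne
    have hB : IsClosedInvariant H (Y \ ⋃ g : H, (fun x : X => g • x) ⁻¹' U) := by
      refine ⟨hY.1.1.sdiff (isOpen_iUnion fun g => hU.preimage (continuous_const_smul g)),
        ⟨y, hyY, hy⟩, fun g x hx => ⟨hY.1.2.2 g x hx.1, fun h => hx.2 ?_⟩⟩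
      obtain ⟨g', hg'⟩ := Set.mem_iUnion.1 h
      exact Set.mem_iUnion.2 ⟨g' * g, by simpa [mul_smul] using hg'⟩
    obtain ⟨z, hzU, hzY⟩ := hUY
    exact (hY.2 hB Set.sdiff_subset hzY).2 (Set.mem_iUnion.2 ⟨1, by simpa using hzU⟩)
  obtain ⟨F, hF⟩ := hY.1.1.isCompact.elim_finite_subcover _
    (fun g => hU.preimage (continuous_const_smul g)) hcov
  refine ⟨F, fun y hy => ?_⟩
  simpa using hF hy

/-- The recurrence step: colouring the words over the alphabet of pairs `(i, a)`, with one more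
letter standing for the identity, by the translate of `U` that the corresponding element moves a
fixed point of `Y` into, a monochromatic combinatorial line is exactly a simultaneous return to
`U`. -/
theorem exists_finset_prod_smul_mem [CommGroup H] [TopologicalSpace X] [CompactSpace X]
    [MulAction H X] [ContinuousConstSMul H X] {Y : Set X} (hY : Minimal (IsClosedInvariant H) Y)
    {ι Λ : Type*} [Finite ι] (S : ι → ℕ → Λ → H) (K : Finset Λ) (N : ℕ) {U : Set X}
    (hU : IsOpen U) (hUY : (U ∩ Y).Nonempty) :
    ∃ V : Finset ℕ, V.Nonempty ∧ (∀ j ∈ V, N < j) ∧ ∃ y ∈ U ∩ Y,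
      ∀ i, ∀ a ∈ K, (∏ j ∈ V, S i j a) • y ∈ U := by
  classical
  obtain ⟨F, hF⟩ := exists_finset_smul_mem hY hU hUY
  obtain ⟨x, hx⟩ := hY.1.2.1
  obtain ⟨κ, hκ, hHJ⟩ := Combinatorics.Line.exists_mono_in_high_dimension (Option (ι × K)) F
  let e : κ → ℕ := fun t => N + 1 + (Fintype.equivFin κ t : ℕ)
  have he : Function.Injective e := fun s t h => by
    have h' : ((Fintype.equivFin κ s : Fin _) : ℕ) = Fintype.equivFin κ t := by
      simpa [e] using h
    exact (Fintype.equivFin κ).injective (Fin.ext h')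
  let step : κ → Option (ι × K) → H := fun t c => c.elim 1 fun p => S p.1 (e t) p.2
  let point : (κ → Option (ι × K)) → X := fun c => (∏ t, step t (c t)) • x
  have hpoint : ∀ c, ∃ f : F, (f : H) • point c ∈ U := fun c => by
    obtain ⟨f, hf, h⟩ := hF _ (hY.1.2.2 (∏ t, step t (c t)) x hx)
    exact ⟨⟨f, hf⟩, h⟩
  choose C hC using hpoint
  obtain ⟨l, f, hl⟩ := hHJ C
  -- the contribution of the coordinates that are constant along the line
  let g₀ : H := ∏ t, if l.idxFun t = none then 1 else step t (l none t)
  have hline : ∀ a, ∏ t, step t (l a t) =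
      (∏ t ∈ Finset.univ.filter (fun t => l.idxFun t = none), step t a) * g₀ := by
    intro a
    rw [Finset.prod_filter, ← Finset.prod_mul_distrib]
    refine Finset.prod_congr rfl fun t _ => ?_
    cases h : l.idxFun t with
    | none => simp [h]
    | some b => simp [h]
  have hmem : ∀ a, (∏ t ∈ Finset.univ.filter (fun t => l.idxFun t = none), step t a) •
      ((f : H) * g₀) • x ∈ U := by
    intro a
    have h := hC (l a)
    rw [hl a] at h
    simp only [point, hline] at h
    rw [← mul_smul] at h ⊢
    convert h using 2
    exact mul_left_comm _ _ _
  obtain ⟨t₀, ht₀⟩ := l.proper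
  refine ⟨(Finset.univ.filter fun t => l.idxFun t = none).image e, ⟨e t₀, ?_⟩, ?_,
    ((f : H) * g₀) • x, ⟨?_, hY.1.2.2 _ _ hx⟩, ?_⟩
  · exact Finset.mem_image_of_mem _ (by simp [ht₀])
  · intro j hj
    obtain ⟨t, -, rfl⟩ := Finset.mem_image.1 hj
    simp only [e]
    omega
  · have h := hmem none
    simpa [step] using h
  · intro i a ha
    rw [Finset.prod_image fun s _ t _ h => he h]
    exact hmem (some (i, ⟨a, ha⟩))

/-- Iterating the recurrence step: open sets `W n` shrinking to a point and successive blocks `V n`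
such that the product over the block `V (n + 1)` maps `W (n + 1)` into `W n`, for every
transformation `i` and every letter of `K (n + 1)`. -/
theorem exists_nested_blocks [CommGroup H] [MetricSpace X] [CompactSpace X]
    [MulAction H X] [ContinuousConstSMul H X] {Y : Set X} (hY : Minimal (IsClosedInvariant H) Y)
    {ι Λ : Type*} [Finite ι] (S : ι → ℕ → Λ → H) (K : ℕ → Finset Λ) {U : Set X}
    (hU : IsOpen U) (hUY : (U ∩ Y).Nonempty) :
    ∃ (V : ℕ → Finset ℕ) (W : ℕ → Set X) (x₀ : X), (∀ n, (V n).Nonempty) ∧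
      (∀ n, ∀ j ∈ V n, n ≤ j ∧ 1 ≤ j) ∧ (∀ n, ∀ j ∈ V n, ∀ j' ∈ V (n + 1), j < j') ∧
      W 0 = U ∧ Antitone W ∧ (∀ n, x₀ ∈ W n) ∧ (∀ O ∈ 𝓝 x₀, ∃ n, W n ⊆ O) ∧
      ∀ n i, ∀ a ∈ K (n + 1), ∀ x ∈ W (n + 1), (∏ j ∈ V (n + 1), S i j a) • x ∈ W n := by
  classical
  -- a state: the open set reached so far and the last block used
  let State := {p : Set X × Finset ℕ // IsOpen p.1 ∧ (p.1 ∩ Y).Nonempty ∧ p.2.Nonempty}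
  have hstep : ∀ (n : ℕ) (s : State), ∃ s' : State,
      (∀ j ∈ s'.1.2, n + 1 ≤ j) ∧ (∀ j ∈ s.1.2, ∀ j' ∈ s'.1.2, j < j') ∧
      closure s'.1.1 ⊆ s.1.1 ∧ (∀ x ∈ closure s'.1.1, ∀ y ∈ s'.1.1, dist y x ≤ 2 / (n + 1)) ∧
      ∀ i, ∀ a ∈ K (n + 1), ∀ x ∈ s'.1.1, (∏ j ∈ s'.1.2, S i j a) • x ∈ s.1.1 := by
    rintro n ⟨⟨O, B⟩, hO, hOY, hB⟩
    obtain ⟨V, hV, hVN, y, ⟨hyO, hyY⟩, hy⟩ :=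
      exists_finset_prod_smul_mem hY S (K (n + 1)) (B.sup id + n) hO hOY
    have hnhds : (O ∩ ⋂ i, ⋂ a ∈ K (n + 1), (fun x : X => (∏ j ∈ V, S i j a) • x) ⁻¹' O) ∈ 𝓝 y := by
      refine Filter.inter_mem (hO.mem_nhds hyO) (Filter.iInter_mem.2 fun i =>
        (Filter.biInter_finset_mem _).2 fun a ha => ?_)
      exact (continuous_const_smul _).continuousAt.preimage_mem_nhds (hO.mem_nhds (hy i a ha))
    obtain ⟨r, hr, hball⟩ := Metric.nhds_basis_closedBall.mem_iff.1 hnhds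
    have hpos : (0 : ℝ) < 1 / (n + 1) := by positivity
    have hclos : closure (Metric.ball y (min r (1 / (n + 1)))) ⊆
        Metric.closedBall y (min r (1 / (n + 1))) := Metric.closure_ball_subset_closedBall
    refine ⟨⟨⟨Metric.ball y (min r (1 / (n + 1))), V⟩, Metric.isOpen_ball,
      ⟨y, Metric.mem_ball_self (lt_min hr hpos), hyY⟩, hV⟩, ?_, ?_, ?_, ?_, ?_⟩
    · intro j hj
      have := hVN j hj
      omega
    · intro j hj j' hj'
      have h1 := hVN j' hj'
      have h2 : j ≤ B.sup id := Finset.le_sup (f := id) hj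
      omega
    · exact fun x hx => (hball (Metric.closedBall_subset_closedBall (min_le_left _ _) (hclos hx))).1
    · intro x hx z hz
      have h1 : dist x y ≤ 1 / (n + 1) :=
        (Metric.mem_closedBall.1 (hclos hx)).trans (min_le_right _ _)
      have h2 : dist z y ≤ 1 / (n + 1) :=
        (Metric.mem_ball.1 hz).le.trans (min_le_right _ _)
      calc dist z x ≤ dist z y + dist x y := dist_triangle_right _ _ _
        _ ≤ 1 / (n + 1) + 1 / (n + 1) := add_le_add h2 h1
        _ = 2 / (n + 1) := by ring
    · intro i a ha x hx
      have := (hball (Metric.closedBall_subset_closedBall (min_le_left _ _)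
        (Metric.ball_subset_closedBall hx))).2
      simp only [Set.mem_iInter] at this
      exact this i a ha
  choose f hf1 hf2 hf3 hf4 hf5 using hstep
  let s : ℕ → State := fun n =>
    n.rec ⟨(U, {1}), hU, hUY, Finset.singleton_nonempty _⟩ fun n s => f n s
  have hsub : ∀ n, closure (s (n + 1)).1.1 ⊆ (s n).1.1 := fun n => hf3 n (s n)
  have hanti : Antitone fun n => (s n).1.1 :=
    antitone_nat_of_succ_le fun n => subset_closure.trans (hsub n)
  obtain ⟨x₀, hx₀⟩ := IsCompact.nonempty_iInter_of_sequence_nonempty_isCompact_isClosed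
    (fun n => closure (s (n + 1)).1.1)
    (fun n => (hsub (n + 1)).trans subset_closure)
    (fun n => ((s (n + 1)).2.2.1.mono Set.inter_subset_left).closure)
    isClosed_closure.isCompact (fun n => isClosed_closure)
  rw [Set.mem_iInter] at hx₀
  refine ⟨fun n => (s n).1.2, fun n => (s n).1.1, x₀, fun n => (s n).2.2.2, ?_,
    fun n => hf2 n (s n), rfl, hanti, fun n => hsub n (hx₀ n), ?_, fun n => hf5 n (s n)⟩
  · rintro (_ | n) j hj
    · have : j = 1 := by simpa [s] using hj
      omega
    · have := hf1 n (s n) j hj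
      omega
  · intro O hO
    obtain ⟨ε, hε, hball⟩ := Metric.mem_nhds_iff.1 hO
    obtain ⟨n, hn⟩ := exists_nat_gt (2 / ε)
    refine ⟨n + 1, fun y hy => hball ?_⟩
    refine lt_of_le_of_lt (hf4 n (s n) x₀ (hx₀ n) y hy) ?_
    rw [div_lt_iff₀ hε] at hn
    rw [div_lt_iff₀ (by positivity)]
    nlinarith

/-- Multiple recurrence along blocks: the products over increasing lists of blocks with large
indices, with an arbitrary letter of `K n` on the block `V n`, bring `x₀` back close to itself. -/
theorem exists_recurrent_point [CommGroup H] [MetricSpace X] [CompactSpace X]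
    [MulAction H X] [ContinuousConstSMul H X] {Y : Set X} (hY : Minimal (IsClosedInvariant H) Y)
    {ι Λ : Type*} [Finite ι] (S : ι → ℕ → Λ → H) (K : ℕ → Finset Λ) {U : Set X}
    (hU : IsOpen U) (hUY : (U ∩ Y).Nonempty) :
    ∃ x₀ ∈ U, ∃ V : ℕ → List ℕ, (∀ n, V n ≠ [] ∧ (V n).Pairwise (· < ·)) ∧
      (∀ n, ∀ j ∈ V n, n ≤ j ∧ 1 ≤ j) ∧ (∀ n, ∀ j ∈ V n, ∀ j' ∈ V (n + 1), j < j') ∧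
      ∀ O ∈ 𝓝 x₀, ∃ M, ∀ (i : ι) (L : List ℕ) (a : ℕ → Λ), L.Pairwise (· < ·) →
        (∀ n ∈ L, M < n ∧ a n ∈ K n) →
        (L.map fun n => ((V n).map fun j => S i j (a n)).prod).prod • x₀ ∈ O := by
  obtain ⟨V, W, x₀, hne, hle, hlt, hW0, hanti, hx₀, hO, hmap⟩ :=
    exists_nested_blocks hY S K hU hUY
  refine ⟨x₀, hW0 ▸ hx₀ 0, fun n => (V n).sort, fun n => ⟨?_, (V n).sortedLT_sort.pairwise⟩,
    fun n j hj => hle n j ((Finset.mem_sort _).1 hj),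
    fun n j hj j' hj' => hlt n j ((Finset.mem_sort _).1 hj) j' ((Finset.mem_sort _).1 hj'), ?_⟩
  · intro h
    obtain ⟨j, hj⟩ := hne n
    have := (Finset.mem_sort (· ≤ ·)).2 hj
    simp_all
  · intro O hOx
    obtain ⟨M, hM⟩ := hO O hOx
    refine ⟨M, fun i L a hL hLM => hM ?_⟩
    have hprod : ∀ n, ((V n).sort.map fun j => S i j (a n)).prod = ∏ j ∈ V n, S i j (a n) := by
      intro n
      rw [← List.prod_toFinset _ ((V n).sort_nodup _), Finset.sort_toFinset]
    simp only [hprod]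
    -- every tail of `L` moves `x₀` into the set preceding its first index
    clear hM hOx hO
    induction L generalizing M with
    | nil => simpa using hx₀ M
    | cons n L ih =>
      rw [List.pairwise_cons] at hL
      have hn := hLM n (by simp)
      have hih := ih n hL.2 fun n' hn' => ⟨hL.1 n' hn', (hLM n' (by simp [hn'])).2⟩
      obtain ⟨n, rfl⟩ : ∃ n', n = n' + 1 := ⟨n - 1, by omega⟩
      rw [List.map_cons, List.prod_cons, mul_smul]
      exact hanti (by omega : M ≤ n) (hmap n i _ hn.2 _ hih)

end Dynamics

/-! ### Located words -/

section Words

variable {I A : Type*}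

/-- The word obtained from `w` by writing the letter `f i` for the variable at each position `i`. -/
def LocWord.fill (f : I → A) (w : LocWord I A) : LocWord I A := fun i =>
  match w i with
  | some Letter.var => some (Letter.const (f i))
  | c => c

/-- Every position of `w` is in the relation `r` to every position of `u`. -/
def Before (r : I → I → Prop) (w u : LocWord I A) : Prop :=
  ∀ i ∈ w.dom, ∀ j ∈ u.dom, r i j

theorem LocWord.mem_dom_of_eq {w : LocWord I A} {i : I} {c : Letter A} (h : w i = some c) :
    i ∈ w.dom := by
  simp [LocWord.dom, h]

theorem LocWord.mem_dom_conc {w u : LocWord I A} {i : I} :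
    i ∈ (w.conc u).dom ↔ i ∈ w.dom ∨ i ∈ u.dom := by
  simp only [LocWord.dom, LocWord.conc, Set.mem_ofPred_eq]
  cases w i <;> simp

theorem LocWord.conc_none (w : LocWord I A) : w.conc (fun _ => none) = w := by
  funext i
  simp [LocWord.conc]

theorem LocWord.conc_eq_some {w u : LocWord I A} {i : I} {c : Letter A}
    (h : w.conc u i = some c) : w i = some c ∨ u i = some c := by
  rw [LocWord.conc, Option.or_eq_some_iff] at h
  exact h.imp id And.right

theorem LocWord.conc_eq_of_left {w u : LocWord I A} {i : I} {c : Letter A}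
    (h : w i = some c) : w.conc u i = some c := by
  simp [LocWord.conc, h]

theorem concList_cons (w : LocWord I A) (l : List (LocWord I A)) :
    concList (w :: l) = w.conc (concList l) := rfl

theorem mem_dom_concList {l : List (LocWord I A)} {i : I} :
    i ∈ (concList l).dom ↔ ∃ w ∈ l, i ∈ w.dom := by
  induction l with
  | nil => simp [concList, LocWord.dom]
  | cons w l ih => simp [concList_cons, LocWord.mem_dom_conc, ih]

theorem concList_mem {C : Set (LocWord I A)} (hC : ∀ w ∈ C, ∀ u ∈ C, w.conc u ∈ C)
    {l : List (LocWord I A)} (hl : l ≠ []) (h : ∀ w ∈ l, w ∈ C) : concList l ∈ C := by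
  induction l with
  | nil => exact absurd rfl hl
  | cons w l ih =>
    rw [concList_cons]
    by_cases hl' : l = []
    · subst hl'
      simpa [concList, LocWord.conc_none] using h
    · exact hC _ (h w (by simp)) _ (ih hl' fun u hu => h u (by simp [hu]))

theorem LocWord.fill_eq_some_const {f : I → A} {w : LocWord I A} {i : I} {a : A}
    (h : w.fill f i = some (Letter.const a)) :
    w i = some (Letter.const a) ∨ w i = some Letter.var ∧ a = f i := by
  unfold LocWord.fill at h
  split at h
  · simp_all
  · exact Or.inl h

theorem LocWord.fill_ne_var (f : I → A) (w : LocWord I A) (i : I) :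
    w.fill f i ≠ some Letter.var := by
  unfold LocWord.fill
  split
  · simp
  · assumption

theorem LocWord.dom_fill (f : I → A) (w : LocWord I A) : (w.fill f).dom = w.dom := by
  ext i
  simp only [LocWord.dom, LocWord.fill, Set.mem_ofPred_eq]
  split <;> simp_all

theorem LocWord.fill_conc (f : I → A) (w u : LocWord I A) :
    (w.conc u).fill f = (w.fill f).conc (u.fill f) := by
  funext i
  simp only [LocWord.conc, LocWord.fill]
  rcases h : w i with _ | _ | _ <;> simp

theorem LocWord.fill_concList (f : I → A) (l : List (LocWord I A)) :
    (concList l).fill f = concList (l.map (LocWord.fill f)) := by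
  induction l with
  | nil => rfl
  | cons w l ih => simp [concList_cons, LocWord.fill_conc, ih]

/-- A system is multiplicative along lists of consecutive words. -/
theorem prod_smul_eq_concList {H X J : Type*} [Monoid H] [MulAction H X] {r : I → I → Prop}
    {C : Set (LocWord I A)} (hC : ∀ w ∈ C, ∀ u ∈ C, w.conc u ∈ C) {T : LocWord I A → X → X}
    (hT : ∀ w ∈ C, ∀ u ∈ C, Before r w u → T w ∘ T u = T (w.conc u))
    {f : J → LocWord I A} {g : J → H} {L : List J} (hL : L ≠ [])
    (hf : ∀ j ∈ L, f j ∈ C) (hg : ∀ j ∈ L, ∀ x, g j • x = T (f j) x)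
    (hr : L.Pairwise fun j j' => Before r (f j) (f j')) (x : X) :
    (L.map g).prod • x = T (concList (L.map f)) x := by
  induction L with
  | nil => exact absurd rfl hL
  | cons j L ih =>
    rw [List.map_cons, List.map_cons, List.prod_cons, concList_cons, mul_smul]
    by_cases hL' : L = []
    · subst hL'
      simpa [concList, LocWord.conc_none] using hg j (by simp) x
    · rw [List.pairwise_cons] at hr
      rw [ih hL' (fun j' h => hf j' (by simp [h])) (fun j' h => hg j' (by simp [h])) hr.2,
        hg j (by simp), ← hT _ (hf j (by simp)) _
          (concList_mem hC (by simpa using hL') (by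
            simp only [List.mem_map]
            rintro _ ⟨j', h, rfl⟩
            exact hf j' (by simp [h])))]
      · rfl
      · intro i hi i' hi'
        obtain ⟨_, hu, hi'⟩ := mem_dom_concList.1 hi'
        obtain ⟨j', h, rfl⟩ := List.mem_map.1 hu
        exact hr.1 j' h i hi i' hi'

end Words

theorem lt_of_lt_of_blocks {V : ℕ → List ℕ} (hne : ∀ n, V n ≠ [])
    (hV : ∀ n, ∀ j ∈ V n, ∀ j' ∈ V (n + 1), j < j') {n n' : ℕ} (h : n < n') :
    ∀ j ∈ V n, ∀ j' ∈ V n', j < j' := by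
  induction n', h using Nat.le_induction with
  | base => exact hV n
  | succ n' _ ih =>
    intro j hj j' hj'
    obtain ⟨b, hb⟩ := List.exists_mem_of_ne_nil _ (hne n')
    exact (ih j hj b hb).trans (hV n' b hb j' hj')

/-- Recurrence for systems of maps indexed by words. The order of words is given by a relation `r`
between positions, and the systems are multiplicative on a class `C` of words. The `n`-th term of
the extraction is the concatenation of the words `w j`, `j ∈ V n`, with no substitution made. -/
theorem exists_recurrent_blocks {I A Λ ι H X : Type*} [CommGroup H] [MetricSpace X]
    [CompactSpace X] [MulAction H X] [ContinuousConstSMul H X] {Y : Set X}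
    (hY : Minimal (IsClosedInvariant H) Y) [Finite ι] {U : Set X} (hU : IsOpen U)
    (hUY : (U ∩ Y).Nonempty) {r : I → I → Prop} {C : Set (LocWord I A)}
    (hC : ∀ w ∈ C, ∀ u ∈ C, w.conc u ∈ C) {T : ι → LocWord I A → X → X}
    (hT : ∀ i, ∀ w ∈ C, ∀ u ∈ C, Before r w u → T i w ∘ T i u = T i (w.conc u))
    (hTH : ∀ i, ∀ w ∈ C, ∃ g : H, ∀ x, g • x = T i w x) (K : ℕ → Finset Λ) (σ : Λ → I → A)
    {w : ℕ → LocWord I A} (hw : ∀ j j', 1 ≤ j → j < j' → Before r (w j) (w j'))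
    (hwC : ∀ n j a, 1 ≤ n → n ≤ j → a ∈ K n → (w j).fill (σ a) ∈ C) :
    ∃ x₀ ∈ U, ∃ V : ℕ → List ℕ, (∀ n, V n ≠ [] ∧ (V n).Pairwise (· < ·)) ∧
      (∀ n, ∀ j ∈ V n, 1 ≤ j) ∧ (∀ n, ∀ j ∈ V n, ∀ j' ∈ V (n + 1), j < j') ∧
      ∀ O ∈ 𝓝 x₀, ∃ M, ∀ (i : ι) (L : List ℕ) (a : ℕ → Λ), L ≠ [] → L.Pairwise (· < ·) →
        (∀ n ∈ L, M < n ∧ a n ∈ K n) →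
        T i (concList (L.map fun n => (concList ((V n).map w)).fill (σ (a n)))) x₀ ∈ O := by
  classical
  let S : ι → ℕ → Λ → H := fun i j a =>
    if h : ∃ g : H, ∀ x, g • x = T i ((w j).fill (σ a)) x then h.choose else 1
  have hS : ∀ i j a, (w j).fill (σ a) ∈ C → ∀ x, S i j a • x = T i ((w j).fill (σ a)) x := by
    intro i j a h
    have h' := hTH i _ h
    simp only [S, dif_pos h']
    exact h'.choose_spec
  obtain ⟨x₀, hx₀, V, hV, hle, hlt, hO⟩ := exists_recurrent_point hY S K hU hUY
  refine ⟨x₀, hx₀, V, hV, fun n j hj => (hle n j hj).2, hlt, fun O hOx => ?_⟩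
  obtain ⟨M, hM⟩ := hO O hOx
  refine ⟨M, fun i L a hL hLlt hLM => ?_⟩
  have hmem : ∀ n ∈ L, ∀ j ∈ V n, (w j).fill (σ (a n)) ∈ C := fun n hn j hj =>
    hwC n j (a n) (by have := hLM n hn; omega) (hle n j hj).1 (hLM n hn).2
  have key := hM i L a hLlt hLM
  rw [prod_smul_eq_concList (T := T i) hC (hT i)
    (f := fun n => concList ((V n).map fun j => (w j).fill (σ (a n)))) hL] at key
  · simpa only [LocWord.fill_concList, List.map_map, Function.comp_def] using key
  · intro n hn
    refine concList_mem hC (by simpa using (hV n).1) ?_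
    simp only [List.mem_map]
    rintro _ ⟨j, hj, rfl⟩
    exact hmem n hn j hj
  · intro n hn x
    refine prod_smul_eq_concList hC (hT i) (hV n).1 (hmem n hn)
      (fun j hj => hS i j _ (hmem n hn j hj)) ?_ x
    refine (hV n).2.imp_of_mem fun {j j'} hj _ h => ?_
    simpa only [Before, LocWord.dom_fill] using hw j j' (hle n j hj).2 h
  · refine hLlt.imp fun {n n'} h p hp p' hp' => ?_
    obtain ⟨_, hu, hp⟩ := mem_dom_concList.1 hp
    obtain ⟨j, hj, rfl⟩ := List.mem_map.1 hu
    obtain ⟨_, hu', hp'⟩ := mem_dom_concList.1 hp'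
    obtain ⟨j', hj', rfl⟩ := List.mem_map.1 hu'
    rw [LocWord.dom_fill] at hp hp'
    exact hw j j' (hle n j hj).2 (lt_of_lt_of_blocks (fun n => (hV n).1) hlt h j hj j' hj')
      p hp p' hp'

/-! ### Extractions over the nonzero integers -/

section Integers

variable {A : Type*} {α : ℤ → A} {k : ℤ → ℕ}

/-- For `j ≠ 0`: `i` lies strictly on the side of `0` as seen from `j`. This is the relation
between positions that underlies `R1`. -/
def IsInner (i j : ℤ) : Prop := (0 < j → i < j) ∧ (j < 0 → j < i)

/-- The words with a negative and a positive position. -/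
def LocWord.TwoSided (w : LocWord ℤ A) : Prop := (∃ i ∈ w.dom, i < 0) ∧ ∃ i ∈ w.dom, 0 < i

/-- On two-sided words avoiding the position `0`, the two pieces in the definition of `R1` have to
be the negative and the positive part of the outer word. -/
theorem R1_iff_before {w u : LocWord ℤ A} (hw : w.TwoSided) (hu : u.TwoSided)
    (hu0 : (0 : ℤ) ∉ u.dom) : R1 w u ↔ Before IsInner w u := by
  obtain ⟨⟨a, ha, ha0⟩, b, hb, hb0⟩ := hw
  constructor
  · rintro ⟨A₁, A₂, hA, -, -, h₁, h₂⟩ i hi j hj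
    rw [hA] at hj
    rcases hj with hj | hj
    · have := h₁ j hj a ha
      have := h₁ j hj i hi
      constructor <;> intro <;> omega
    · have := h₂ b hb j hj
      have := h₂ i hi j hj
      constructor <;> intro <;> omega
  · intro h
    obtain ⟨⟨c, hc, hc0⟩, d, hd, hd0⟩ := hu
    refine ⟨{j ∈ u.dom | j < 0}, {j ∈ u.dom | 0 < j}, ?_, ⟨c, hc, hc0⟩, ⟨d, hd, hd0⟩,
      fun j hj i hi => (h i hi j hj.1).2 hj.2, fun i hi j hj => (h i hi j hj.1).1 hj.2⟩
    ext j
    constructor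
    · intro hj
      have : j ≠ 0 := fun h0 => hu0 (h0 ▸ hj)
      rcases lt_or_gt_of_ne this with h0 | h0
      · exact Or.inl ⟨hj, h0⟩
      · exact Or.inr ⟨hj, h0⟩
    · rintro (hj | hj) <;> exact hj.1

theorem conc_mem_wordsZ {w u : LocWord ℤ A} (hw : w ∈ WordsZ α k) (hu : u ∈ WordsZ α k) :
    w.conc u ∈ WordsZ α k := by
  have hdom : (w.conc u).dom = w.dom ∪ u.dom := Set.ext fun _ => LocWord.mem_dom_conc
  obtain ⟨hw1, hw2, hw3, hw4, hw5⟩ := hw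
  obtain ⟨hu1, hu2, hu3, hu4, hu5⟩ := hu
  refine ⟨hdom ▸ hw1.union hu1, hdom ▸ hw2.inl, ?_, fun i hi a ha => ?_, fun i hi a ha => ?_⟩
  · rw [hdom]
    exact fun h => h.elim hw3 hu3
  · exact (LocWord.conc_eq_some ha).elim (hw4 i hi a) (hu4 i hi a)
  · exact (LocWord.conc_eq_some ha).elim (hw5 i hi a) (hu5 i hi a)

theorem conc_mem_constZ {w u : LocWord ℤ A} (hw : w ∈ ConstZ α k) (hu : u ∈ ConstZ α k) :
    w.conc u ∈ ConstZ α k :=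
  ⟨conc_mem_wordsZ hw.1 hu.1, fun i h => (LocWord.conc_eq_some h).elim (hw.2 i) (hu.2 i)⟩

theorem conc_mem_varZ₀ {w u : LocWord ℤ A} (hw : w ∈ VarZ₀ α k) (hu : u ∈ VarZ₀ α k) :
    w.conc u ∈ VarZ₀ α k := by
  obtain ⟨hw1, ⟨i, hi, hwi⟩, j, hj, hwj⟩ := hw
  exact ⟨conc_mem_wordsZ hw1 hu.1, ⟨i, hi, LocWord.conc_eq_of_left hwi⟩,
    j, hj, LocWord.conc_eq_of_left hwj⟩

theorem twoSided_of_mem_varZ₀ {w : LocWord ℤ A} (hw : w ∈ VarZ₀ α k) : w.TwoSided := by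
  obtain ⟨-, ⟨i, hi, hwi⟩, j, hj, hwj⟩ := hw
  exact ⟨⟨i, LocWord.mem_dom_of_eq hwi, hi⟩, j, LocWord.mem_dom_of_eq hwj, hj⟩

theorem substZ_some (w : LocWord ℤ A) (p q : ℕ) :
    substZ α w (some (p, q)) = w.fill fun i => if 0 < i then α p else α (-(q : ℤ)) := by
  funext i
  rcases h : w i with _ | _ | _ <;> simp only [substZ, LocWord.fill, h]
  split <;> rfl

theorem before_of_mem_seqZ {w : ℕ → LocWord ℤ A} (hw : w ∈ SeqZ α k) {j j' : ℕ} (hj : 1 ≤ j)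
    (h : j < j') : Before IsInner (w j) (w j') := by
  have hsucc : ∀ n, 1 ≤ n → Before IsInner (w n) (w (n + 1)) := fun n hn =>
    (R1_iff_before (twoSided_of_mem_varZ₀ (hw n hn).1)
      (twoSided_of_mem_varZ₀ (hw (n + 1) (by omega)).1) (hw (n + 1) (by omega)).1.1.2.2.1).1
      (hw n hn).2
  induction j', h using Nat.le_induction with
  | base => exact hsucc j hj
  | succ n hn ih =>
    intro i hi i' hi'
    obtain ⟨⟨a, ha, ha0⟩, b, hb, hb0⟩ := twoSided_of_mem_varZ₀ (hw n (by omega)).1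
    have h1 := (ih i hi a ha).2 ha0
    have h2 := (ih i hi b hb).1 hb0
    have h3 := hsucc n (by omega) a ha i' hi'
    have h4 := hsucc n (by omega) b hb i' hi'
    exact ⟨fun h => h2.trans (h4.1 h), fun h => (h3.2 h).trans h1⟩

/-- The outward order of the `w n` pushes them away from `0`, so that a letter allowed for the
index `n` is allowed at every position of `w j`, `j ≥ n`. -/
theorem le_abs_of_mem_seqZ {w : ℕ → LocWord ℤ A} (hw : w ∈ SeqZ α k) {j : ℕ} (hj : 1 ≤ j) :
    ∀ i ∈ (w j).dom, (0 < i → (j : ℤ) ≤ i) ∧ (i < 0 → (j : ℤ) ≤ -i) := by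
  induction j, hj using Nat.le_induction with
  | base => exact fun i _ => ⟨fun h => by push_cast; omega, fun h => by push_cast; omega⟩
  | succ n hn ih =>
    intro i hi
    obtain ⟨⟨a, ha, ha0⟩, b, hb, hb0⟩ := twoSided_of_mem_varZ₀ (hw n hn).1
    have h1 := (ih a ha).2 ha0
    have h2 := (ih b hb).1 hb0
    have h3 := before_of_mem_seqZ hw hn (Nat.lt_succ_self n) a ha i hi
    have h4 := before_of_mem_seqZ hw hn (Nat.lt_succ_self n) b hb i hi
    push_cast
    exact ⟨fun h => by have := h4.1 h; omega, fun h => by have := h3.2 h; omega⟩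

theorem fill_mem_constZ (hk : IsDominatingZ k) {w : ℕ → LocWord ℤ A} (hw : w ∈ SeqZ α k)
    {n j p q : ℕ} (hn : 1 ≤ n) (hnj : n ≤ j) (hp : 1 ≤ p ∧ p ≤ k n)
    (hq : 1 ≤ q ∧ q ≤ k (-(n : ℤ))) :
    (w j).fill (fun i => if 0 < i then α p else α (-(q : ℤ))) ∈ ConstZ α k := by
  have hwj := (hw j (hn.trans hnj)).1.1
  refine ⟨⟨?_, ?_, ?_, fun i hi a ha => ?_, fun i hi a ha => ?_⟩, LocWord.fill_ne_var _ _⟩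
  · rw [LocWord.dom_fill]
    exact hwj.1
  · rw [LocWord.dom_fill]
    exact hwj.2.1
  · rw [LocWord.dom_fill]
    exact hwj.2.2.1
  · rcases LocWord.fill_eq_some_const ha with h | ⟨h, rfl⟩
    · exact hwj.2.2.2.1 i hi a h
    · have := (le_abs_of_mem_seqZ hw (hn.trans hnj) i (LocWord.mem_dom_of_eq h)).1 hi
      exact ⟨p, hp.1, hp.2.trans (hk.2.1 n i (by omega) (by omega)), by simp [hi]⟩
  · rcases LocWord.fill_eq_some_const ha with h | ⟨h, rfl⟩
    · exact hwj.2.2.2.2 i hi a h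
    · have := (le_abs_of_mem_seqZ hw (hn.trans hnj) i (LocWord.mem_dom_of_eq h)).2 hi
      have hle := hk.2.2 n (-i) (by omega) (by omega)
      rw [neg_neg] at hle
      exact ⟨q, hq.1, hq.2.trans hle, by simp [hi.le]⟩

theorem exists_extractionZ {ι H X : Type*} [CommGroup H] [MetricSpace X] [CompactSpace X]
    [MulAction H X] [ContinuousConstSMul H X] [Finite ι] (hk : IsDominatingZ k)
    {T : ι → LocWord ℤ A → X → X} (hT : ∀ i, IsSystemZ α k (T i))
    (hTH : ∀ i, ∀ w ∈ ConstZ α k, ∃ g : H, ∀ x, g • x = T i w x) {w : ℕ → LocWord ℤ A}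
    (hw : w ∈ SeqZ α k) {Y : Set X} (hY : Minimal (IsClosedInvariant H) Y) {U : Set X}
    (hU : IsOpen U) (hUY : (U ∩ Y).Nonempty) :
    ∃ x₀ ∈ U, ∃ u : ℕ → LocWord ℤ A, IsExtractionZ α k u w ∧
      ∀ i, R1Lim (EZ α k u) (fun z => T i z x₀) x₀ := by
  have hC : ∀ v ∈ {v | v ∈ ConstZ α k ∧ v.TwoSided}, ∀ v' ∈ {v | v ∈ ConstZ α k ∧ v.TwoSided},
      v.conc v' ∈ {v | v ∈ ConstZ α k ∧ v.TwoSided} := by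
    rintro v ⟨hv, ⟨a, ha, ha0⟩, b, hb, hb0⟩ v' ⟨hv', -⟩
    exact ⟨conc_mem_constZ hv hv', ⟨a, LocWord.mem_dom_conc.2 (Or.inl ha), ha0⟩,
      b, LocWord.mem_dom_conc.2 (Or.inl hb), hb0⟩
  obtain ⟨x₀, hx₀, V, hV, hV1, hlt, hlim⟩ := exists_recurrent_blocks (H := H)
    (Λ := ℕ × ℕ) hY hU hUY hC (T := T)
    (fun i v hv v' hv' h => (hT i).2 v hv.1 v' hv'.1
      ((R1_iff_before hv.2 hv'.2 hv'.1.1.2.2.1).2 h))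
    (fun i v hv => hTH i v hv.1)
    (fun n => Finset.Icc 1 (k n) ×ˢ Finset.Icc 1 (k (-(n : ℤ))))
    (fun a i => if 0 < i then α a.1 else α (-(a.2 : ℤ)))
    (fun j j' hj h => before_of_mem_seqZ hw hj h)
    (by
      rintro n j ⟨p, q⟩ hn hnj ha
      simp only [Finset.mem_product, Finset.mem_Icc] at ha
      refine ⟨fill_mem_constZ hk hw hn hnj ha.1 ha.2, ?_⟩
      simpa only [LocWord.TwoSided, LocWord.dom_fill] using
        twoSided_of_mem_varZ₀ (hw j (hn.trans hnj)).1)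
  have hu : ∀ n, concList ((V n).map w) ∈ VarZ₀ α k := by
    intro n
    refine concList_mem (fun _ h _ h' => conc_mem_varZ₀ h h') (by simpa using (hV n).1) ?_
    simp only [List.mem_map]
    rintro _ ⟨j, hj, rfl⟩
    exact (hw j (hV1 n j hj)).1
  refine ⟨x₀, hx₀, fun n => concList ((V n).map w), ⟨fun n _ => ⟨hu n, ?_⟩, fun n _ => ⟨hu n, V n,
    fun _ => none, (hV n).1, (hV n).2, fun j hj => ⟨hV1 n j hj, by simp⟩, ?_, rfl⟩⟩, ?_⟩
  · rw [R1_iff_before (twoSided_of_mem_varZ₀ (hu n)) (twoSided_of_mem_varZ₀ (hu (n + 1)))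
      (hu (n + 1)).1.2.2.1]
    intro i hi i' hi'
    obtain ⟨_, hv, hi⟩ := mem_dom_concList.1 hi
    obtain ⟨j, hj, rfl⟩ := List.mem_map.1 hv
    obtain ⟨_, hv', hi'⟩ := mem_dom_concList.1 hi'
    obtain ⟨j', hj', rfl⟩ := List.mem_map.1 hv'
    exact before_of_mem_seqZ hw (hV1 n j hj) (hlt n j hj j' hj') i hi i' hi'
  · obtain ⟨j, hj⟩ := List.exists_mem_of_ne_nil _ (hV n).1
    exact ⟨j, hj, rfl⟩
  · intro i O hO
    obtain ⟨M, hM⟩ := hlim O hO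
    -- a word whose positions all lie beyond `n₀` uses no term of index at most `M`
    have hpos : ∀ n, ∃ b : ℕ, 0 < b ∧ (b : ℤ) ∈ (concList ((V n).map w)).dom := by
      intro n
      obtain ⟨-, b, hb, hb0⟩ := twoSided_of_mem_varZ₀ (hu n)
      lift b to ℕ using hb0.le
      exact ⟨b, by exact_mod_cast hb0, hb⟩
    choose b hb0 hb using hpos
    refine ⟨(Finset.range (M + 1)).sup b + 1, ?_⟩
    rintro z ⟨-, L, p, q, hL, hLlt, hLpq, rfl⟩ - hz
    simp only [substZ_some] at hz ⊢
    refine hM i L (fun n => (p n, q n)) hL hLlt fun n hn => ⟨?_, ?_⟩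
    · by_contra hnM
      have hle := hz (b n) (mem_dom_concList.2
        ⟨_, List.mem_map_of_mem hn, by rw [LocWord.dom_fill]; exact hb n⟩)
        (by exact_mod_cast hb0 n)
      have : b n ≤ (Finset.range (M + 1)).sup b :=
        Finset.le_sup (f := b) (Finset.mem_range.2 (by omega))
      omega
    · have := hLpq n hn
      simp only [Finset.mem_product, Finset.mem_Icc]
      exact ⟨⟨this.2.1, this.2.2.1⟩, this.2.2.2⟩

end Integers

/-! ### Extractions over the positive integers -/

section Naturals

variable {A : Type*} {α : ℕ → A} {k : ℕ → ℕ}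

theorem conc_mem_wordsN {w u : LocWord ℕ A} (hw : w ∈ WordsN α k) (hu : u ∈ WordsN α k) :
    w.conc u ∈ WordsN α k := by
  have hdom : (w.conc u).dom = w.dom ∪ u.dom := Set.ext fun _ => LocWord.mem_dom_conc
  obtain ⟨hw1, hw2, hw3, hw4⟩ := hw
  obtain ⟨hu1, hu2, hu3, hu4⟩ := hu
  refine ⟨hdom ▸ hw1.union hu1, hdom ▸ hw2.inl, ?_, fun i hi a ha => ?_⟩
  · rw [hdom]
    exact fun h => h.elim hw3 hu3
  · exact (LocWord.conc_eq_some ha).elim (hw4 i hi a) (hu4 i hi a)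

theorem conc_mem_constN {w u : LocWord ℕ A} (hw : w ∈ ConstN α k) (hu : u ∈ ConstN α k) :
    w.conc u ∈ ConstN α k :=
  ⟨conc_mem_wordsN hw.1 hu.1, fun i h => (LocWord.conc_eq_some h).elim (hw.2 i) (hu.2 i)⟩

theorem conc_mem_varN {w u : LocWord ℕ A} (hw : w ∈ VarN α k) (hu : u ∈ VarN α k) :
    w.conc u ∈ VarN α k := by
  obtain ⟨hw1, i, hwi⟩ := hw
  exact ⟨conc_mem_wordsN hw1 hu.1, i, LocWord.conc_eq_of_left hwi⟩

theorem substN_some (w : LocWord ℕ A) (p : ℕ) :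
    substN α w (some p) = w.fill fun _ => α p := by
  funext i
  rcases h : w i with _ | _ | _ <;> simp [substN, LocWord.fill, h]

theorem R2_of_mem_seqN {w : ℕ → LocWord ℕ A} (hw : w ∈ SeqN α k) {j j' : ℕ} (hj : 1 ≤ j)
    (h : j < j') : R2 (w j) (w j') := by
  induction j', h using Nat.le_induction with
  | base => exact (hw j hj).2
  | succ n hn ih =>
    intro i hi i' hi'
    obtain ⟨a, ha⟩ := (hw n (by omega)).1.1.2.1
    exact (ih i hi a ha).trans ((hw n (by omega)).2 a ha i' hi')

theorem le_of_mem_seqN {w : ℕ → LocWord ℕ A} (hw : w ∈ SeqN α k) {j : ℕ} (hj : 1 ≤ j) :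
    ∀ i ∈ (w j).dom, j ≤ i := by
  induction j, hj using Nat.le_induction with
  | base => exact fun i hi => Nat.one_le_iff_ne_zero.2 fun h =>
      (hw 1 le_rfl).1.1.2.2.1 (h ▸ hi)
  | succ n hn ih =>
    intro i hi
    obtain ⟨a, ha⟩ := (hw n hn).1.1.2.1
    exact (ih a ha).trans_lt ((hw n hn).2 a ha i hi)

theorem fill_mem_constN (hk : IsDominatingN k) {w : ℕ → LocWord ℕ A} (hw : w ∈ SeqN α k)
    {n j p : ℕ} (hn : 1 ≤ n) (hnj : n ≤ j) (hp : 1 ≤ p ∧ p ≤ k n) :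
    (w j).fill (fun _ => α p) ∈ ConstN α k := by
  have hwj := (hw j (hn.trans hnj)).1.1
  refine ⟨⟨?_, ?_, ?_, fun i hi a ha => ?_⟩, LocWord.fill_ne_var _ _⟩
  · rw [LocWord.dom_fill]
    exact hwj.1
  · rw [LocWord.dom_fill]
    exact hwj.2.1
  · rw [LocWord.dom_fill]
    exact hwj.2.2.1
  · rcases LocWord.fill_eq_some_const ha with h | ⟨h, rfl⟩
    · exact hwj.2.2.2 i hi a h
    · have := le_of_mem_seqN hw (hn.trans hnj) i (LocWord.mem_dom_of_eq h)
      exact ⟨p, hp.1, hp.2.trans (hk.2 n i hn (hnj.trans this)), rfl⟩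

theorem exists_extractionN {ι H X : Type*} [CommGroup H] [MetricSpace X] [CompactSpace X]
    [MulAction H X] [ContinuousConstSMul H X] [Finite ι] (hk : IsDominatingN k)
    {T : ι → LocWord ℕ A → X → X} (hT : ∀ i, IsSystemN α k (T i))
    (hTH : ∀ i, ∀ w ∈ ConstN α k, ∃ g : H, ∀ x, g • x = T i w x) {w : ℕ → LocWord ℕ A}
    (hw : w ∈ SeqN α k) {Y : Set X} (hY : Minimal (IsClosedInvariant H) Y) {U : Set X}
    (hU : IsOpen U) (hUY : (U ∩ Y).Nonempty) :
    ∃ x₀ ∈ U, ∃ u : ℕ → LocWord ℕ A, IsExtractionN α k u w ∧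
      ∀ i, R2Lim (EN α k u) (fun z => T i z x₀) x₀ := by
  obtain ⟨x₀, hx₀, V, hV, hV1, hlt, hlim⟩ := exists_recurrent_blocks (H := H)
    hY hU hUY (C := ConstN α k) (fun _ h _ h' => conc_mem_constN h h') (T := T)
    (r := (· < ·)) (fun i => (hT i).2) hTH (fun n => Finset.Icc 1 (k n)) (fun p _ => α p)
    (fun j j' hj h => R2_of_mem_seqN hw hj h)
    (fun n j p hn hnj hp => fill_mem_constN hk hw hn hnj (Finset.mem_Icc.1 hp))
  have hu : ∀ n, concList ((V n).map w) ∈ VarN α k := by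
    intro n
    refine concList_mem (fun _ h _ h' => conc_mem_varN h h') (by simpa using (hV n).1) ?_
    simp only [List.mem_map]
    rintro _ ⟨j, hj, rfl⟩
    exact (hw j (hV1 n j hj)).1
  refine ⟨x₀, hx₀, fun n => concList ((V n).map w), ⟨fun n _ => ⟨hu n, ?_⟩, fun n _ => ⟨hu n, V n,
    fun _ => none, (hV n).1, (hV n).2, fun j hj => ⟨hV1 n j hj, by simp⟩, ?_, rfl⟩⟩, ?_⟩
  · intro i hi i' hi'
    obtain ⟨_, hv, hi⟩ := mem_dom_concList.1 hi
    obtain ⟨j, hj, rfl⟩ := List.mem_map.1 hv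
    obtain ⟨_, hv', hi'⟩ := mem_dom_concList.1 hi'
    obtain ⟨j', hj', rfl⟩ := List.mem_map.1 hv'
    exact R2_of_mem_seqN hw (hV1 n j hj) (hlt n j hj j' hj') i hi i' hi'
  · obtain ⟨j, hj⟩ := List.exists_mem_of_ne_nil _ (hV n).1
    exact ⟨j, hj, rfl⟩
  · intro i O hO
    obtain ⟨M, hM⟩ := hlim O hO
    -- a word whose positions all lie beyond `n₀` uses no term of index at most `M`
    choose b hb using fun n => (hu n).1.2.1
    refine ⟨(Finset.range (M + 1)).sup b + 1, ?_⟩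
    rintro z ⟨-, L, p, hL, hLlt, hLp, rfl⟩ hz
    simp only [substN_some] at hz ⊢
    refine hM i L p hL hLlt fun n hn => ⟨?_, Finset.mem_Icc.2 (hLp n hn).2⟩
    by_contra hnM
    have hle := hz (b n) (mem_dom_concList.2
      ⟨_, List.mem_map_of_mem hn, by rw [LocWord.dom_fill]; exact hb n⟩)
    have : b n ≤ (Finset.range (M + 1)).sup b :=
      Finset.le_sup (f := b) (Finset.mem_range.2 (by omega))
    omega

end Naturals

/-! ### Existence and density of recurrent points -/

/-- A set that meets every open set meeting a minimal set is non-empty, and is dense if the whole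
space is minimal. -/
theorem nonempty_and_dense_of_minimal {H X : Type*} [TopologicalSpace X] [CompactSpace X]
    [Nonempty X] [SMul H X] {D : Set X}
    (hD : ∀ Y : Set X, Minimal (IsClosedInvariant H) Y → ∀ U : Set X, IsOpen U →
      (U ∩ Y).Nonempty → ∃ x ∈ U, x ∈ D) :
    D.Nonempty ∧ (Minimal (IsClosedInvariant H) (Set.univ : Set X) → Dense D) := by
  refine ⟨?_, fun hmin => dense_iff_inter_open.2 fun U hU hne => ?_⟩
  · obtain ⟨Y, hY⟩ := exists_minimal_isClosedInvariant H X
    obtain ⟨x, -, hx⟩ := hD Y hY Set.univ isOpen_univ (by simpa using hY.1.2.1)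
    exact ⟨x, hx⟩
  · obtain ⟨x, hxU, hx⟩ := hD _ hmin U hU (by simpa using hne)
    exact ⟨x, hxU, hx⟩

end OmegaWords

theorem theorem114 {X : Type*} [MetricSpace X] [CompactSpace X] [Nonempty X]
    (G : Subgroup (X ≃ₜ X)) (hG : ∀ f ∈ G, ∀ g ∈ G, f * g = g * f)
    {A : Type*} (m : ℕ) :
    -- words over positions in the nonzero integers
    (∀ (α : ℤ → A) (k : ℤ → ℕ), IsDominatingZ k →
      ∀ T : Fin m → LocWord ℤ A → X → X,
        (∀ i, IsSystemZ α k (T i)) →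
        (∀ i, ∀ w ∈ ConstZ α k, ∃ g ∈ G, ⇑g = T i w) →
        ∀ w ∈ SeqZ α k,
          (∃ x₀ : X, ∃ u : ℕ → LocWord ℤ A, IsExtractionZ α k u w ∧
            ∀ i, R1Lim (EZ α k u) (fun z => T i z x₀) x₀) ∧
          (IsMinimalGroup G →
            Dense {x₀ : X | ∃ u : ℕ → LocWord ℤ A, IsExtractionZ α k u w ∧
              ∀ i, R1Lim (EZ α k u) (fun z => T i z x₀) x₀})) ∧
    -- words over positions in the positive integers
    (∀ (α : ℕ → A) (k : ℕ → ℕ), IsDominatingN k →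
      ∀ T : Fin m → LocWord ℕ A → X → X,
        (∀ i, IsSystemN α k (T i)) →
        (∀ i, ∀ w ∈ ConstN α k, ∃ g ∈ G, ⇑g = T i w) →
        ∀ w ∈ SeqN α k,
          (∃ x₀ : X, ∃ u : ℕ → LocWord ℕ A, IsExtractionN α k u w ∧
            ∀ i, R2Lim (EN α k u) (fun z => T i z x₀) x₀) ∧
          (IsMinimalGroup G →
            Dense {x₀ : X | ∃ u : ℕ → LocWord ℕ A, IsExtractionN α k u w ∧
              ∀ i, R2Lim (EN α k u) (fun z => T i z x₀) x₀})) := by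
  let _ : CommGroup G :=
    { (inferInstance : Group G) with mul_comm := fun f g => Subtype.ext (hG f f.2 g g.2) }
  let _ : MulAction G X :=
    { smul := fun g x => (g : X ≃ₜ X) x
      one_smul := fun _ => rfl
      mul_smul := fun _ _ _ => rfl }
  have : ContinuousConstSMul G X := ⟨fun g => (g : X ≃ₜ X).continuous⟩
  have hmin : IsMinimalGroup G → Minimal (IsClosedInvariant G) (Set.univ : Set X) := fun h =>
    ⟨⟨isClosed_univ, Set.univ_nonempty, fun _ _ _ => trivial⟩, fun B hB _ =>
      (h B hB.1 hB.2.1 fun g hg => Set.image_subset_iff.2 fun x hx => hB.2.2 ⟨g, hg⟩ x hx).ge⟩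
  have hmaps : ∀ f : X → X, (∃ g ∈ G, ⇑g = f) → ∃ g : G, ∀ x : X, g • x = f x := by
    rintro _ ⟨g, hg, rfl⟩
    exact ⟨⟨g, hg⟩, fun _ => rfl⟩
  constructor
  · intro α k hk T hT hTG w hw
    have h := nonempty_and_dense_of_minimal (H := G) fun Y hY U hU hUY =>
      exists_extractionZ hk hT (fun i v hv => hmaps _ (hTG i v hv)) hw hY hU hUY
    exact ⟨h.1, fun hG' => h.2 (hmin hG')⟩
  · intro α k hk T hT hTG w hw
    have h := nonempty_and_dense_of_minimal (H := G) fun Y hY U hU hUY =>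
      exists_extractionN hk hT (fun i v hv => hmaps _ (hTG i v hv)) hw hY hU hUY
    exact ⟨h.1, fun hG' => h.2 (hmin hG')⟩
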